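/- Let $p$ be an odd prime, let $n$ be a positive integer with $p \mid n$, and let $v_p(n)$ denote the exponent of $p$ in $n$. Let $a, b \in \mathbb{Z}_p$ be roots of unity such that $b^n = a^{-n}$. For each integer $e \ge 1$ let $T_{a,b,e}$ be the set of pairs of integers $(x,y)$ with $1 \le x, y \le p^e(p-1)$, $p \nmid x$, $p \nmid y$, $x \equiv a \pmod p$, $y \equiv b \pmod p$, such that $$x^{x^n} \equiv y \pmod{p^e} \quad\text{and}\quad y^{y^n} \equiv x \pmod{p^e}.$$ Then for all $e \ge 1$, $$|T_{a,b,e}| = |T_{a,b,1}| \cdot \begin{cases} p^{e-1} & \text{if } e \le v_p(n) \text{ and } b^n \ne -1,\\ p^{\lfloor (e+v_p(n))/2 \rfloor} & \text{if } e \ge v_p(n)+1 \text{ and } b^n \ne -1,\\ p^{e-1} & \text{if } e \le 2v_p(n) \text{ and } b^n = -1,\\ p^{\lfloor (e+v_p(n))/3 \rfloor + \lfloor (e+v_p(n)+1)/3 \rfloor} & \text{if } e \ge 2v_p(n)+1 \text{ and } b^n = -1. \end{cases}$$ -/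

import Mathlib

/-- The set of pairs `(x, y)` of integers with `1 ≤ x, y ≤ p ^ e * (p - 1)`, both prime to `p`,
lying in the residue classes of the `p`-adic integers `a` and `b` modulo `p`, and forming
a two-cycle `x ^ (x ^ n) ≡ y`, `y ^ (y ^ n) ≡ x` modulo `p ^ e`. -/
def twoCycles (p : ℕ) [Fact p.Prime] (n : ℕ) (a b : ℤ_[p]) (e : ℕ) : Set (ℕ × ℕ) :=
  {z | (1 ≤ z.1 ∧ z.1 ≤ p ^ e * (p - 1)) ∧ (1 ≤ z.2 ∧ z.2 ≤ p ^ e * (p - 1)) ∧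
    ¬ p ∣ z.1 ∧ ¬ p ∣ z.2 ∧
    (p : ℤ_[p]) ∣ (z.1 : ℤ_[p]) - a ∧ (p : ℤ_[p]) ∣ (z.2 : ℤ_[p]) - b ∧
    z.1 ^ (z.1 ^ n) ≡ z.2 [MOD p ^ e] ∧ z.2 ^ (z.2 ^ n) ≡ z.1 [MOD p ^ e]}

theorem twoCycles_finite (p : ℕ) [Fact p.Prime] (n : ℕ) (a b : ℤ_[p]) (e : ℕ) :
    (twoCycles p n a b e).Finite := by
  refine ((Set.finite_Icc 1 (p ^ e * (p - 1))).prod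
    (Set.finite_Icc 1 (p ^ e * (p - 1)))).subset ?_
  rintro z ⟨h1, h2, -⟩
  exact ⟨h1, h2⟩

/-! ### Divisibility in `ℤ_[p]`: 1-units and roots of unity. -/

namespace PadicInt

variable {p : ℕ} [Fact p.Prime]

/-! Write `x = aA`, `y = bB` with 1-units `A`, `B`, and `N = x ^ n`, `M = y ^ n`. The root-of-unity
parts depend only on `x`, `y` mod `p - 1`. The rest is `A ^ N ≡ B`, `B ^ M ≡ A`, and `NM = (AB) ^
n`. Lifting the exponent turns the second congruence into `e ≤ v(n) + 2 v(A - 1) + v(N + 1)`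
(`pow_dvd_pow_sub_iff`). Since `N = a ^ n * A ^ n`, the last term is `0` if `a ^ n ≠ -1` and `v(A -
1) + v(n)` otherwise. Either way the condition is `x ≡ a` mod `p ^ k` for an explicit `k`. By the
Chinese remainder theorem the residues mod `p - 1` are independent of `x` mod `p ^ e`, which has `p
^ (e - k)` values and determines `y` mod `p ^ e` (`ncard_twoCycles`). -/

theorem pow_dvd_natCast_sub_iff (x y k : ℕ) :
    (p : ℤ_[p]) ^ k ∣ (x : ℤ_[p]) - y ↔ x ≡ y [MOD p ^ k] := by
  have h := pow_p_dvd_int_iff (p := p) k ((x : ℤ) - y)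
  push_cast at h
  rw [h, Nat.ModEq.comm, Nat.modEq_iff_dvd]
  push_cast
  rfl

theorem natCast_dvd_iff (m : ℕ) : (p : ℤ_[p]) ∣ m ↔ p ∣ m := by
  have h := pow_dvd_natCast_sub_iff (p := p) m 0 1
  simpa [Nat.modEq_zero_iff_dvd] using h

theorem not_dvd_of_dvd_sub_one {A : ℤ_[p]} (hA : (p : ℤ_[p]) ∣ A - 1) : ¬ (p : ℤ_[p]) ∣ A := by
  intro h
  have : (p : ℤ_[p]) ∣ 1 := by simpa using dvd_sub h hA
  exact prime_p.not_isUnit (isUnit_of_dvd_one this)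

theorem not_dvd_unit (u : ℤ_[p]ˣ) : ¬ (p : ℤ_[p]) ∣ u :=
  fun h => prime_p.not_isUnit (isUnit_of_dvd_unit h u.isUnit)

/-- Lifting the exponent for `1`-units of `ℤ_[p]`, `p` odd. -/
theorem emultiplicity_pow_sub_one (hp : p ≠ 2) {A : ℤ_[p]} (hA : (p : ℤ_[p]) ∣ A - 1) (m : ℕ) :
    emultiplicity (p : ℤ_[p]) (A ^ m - 1) = emultiplicity (p : ℤ_[p]) ((A - 1) * m) := by
  have hpp : p.Prime := Fact.out
  rcases eq_or_ne m 0 with rfl | hm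
  · simp
  obtain ⟨k, m', hm', rfl⟩ := Nat.exists_eq_pow_mul_and_not_dvd hm p hpp.ne_one
  have hm'' : ¬ (p : ℤ_[p]) ∣ m' := by rwa [natCast_dvd_iff]
  have hA' : (p : ℤ_[p]) ∣ A ^ p ^ k - 1 :=
    hA.trans (by simpa using sub_dvd_pow_sub_pow A 1 (p ^ k))
  have h1 := emultiplicity_pow_sub_pow_of_prime prime_p (x := A ^ p ^ k) (y := 1) hA'
    (not_dvd_of_dvd_sub_one hA') hm''
  have h2 := emultiplicity_pow_prime_pow_sub_pow_prime_pow (x := A) (y := 1) prime_p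
    (hpp.odd_of_ne_two hp) hA (not_dvd_of_dvd_sub_one hA) k
  simp only [one_pow] at h1 h2
  rw [pow_mul, h1, h2, emultiplicity_mul prime_p]
  push_cast
  rw [emultiplicity_mul prime_p, emultiplicity_eq_zero.2 hm'', add_zero,
    emultiplicity_pow_self prime_p.ne_zero prime_p.not_isUnit]

theorem pow_dvd_mul_congr {z w : ℤ_[p]}
    (h : emultiplicity (p : ℤ_[p]) z = emultiplicity (p : ℤ_[p]) w) (c : ℤ_[p]) (e : ℕ) :
    (p : ℤ_[p]) ^ e ∣ c * z ↔ (p : ℤ_[p]) ^ e ∣ c * w := by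
  simp only [pow_dvd_iff_le_emultiplicity, emultiplicity_mul prime_p, h]

theorem pow_dvd_mul_pow_sub_one_iff (hp : p ≠ 2) {A : ℤ_[p]} (hA : (p : ℤ_[p]) ∣ A - 1) (m : ℕ)
    (c : ℤ_[p]) (e : ℕ) :
    (p : ℤ_[p]) ^ e ∣ c * (A ^ m - 1) ↔ (p : ℤ_[p]) ^ e ∣ c * ((A - 1) * m) :=
  pow_dvd_mul_congr (emultiplicity_pow_sub_one hp hA m) c e

theorem pow_dvd_mul_unit_iff {z : ℤ_[p]} (hz : ¬ (p : ℤ_[p]) ∣ z) (c : ℤ_[p]) (e : ℕ) :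
    (p : ℤ_[p]) ^ e ∣ c * z ↔ (p : ℤ_[p]) ^ e ∣ c := by
  simp only [pow_dvd_iff_le_emultiplicity, emultiplicity_mul prime_p, emultiplicity_eq_zero.2 hz,
    add_zero]

/-- Lifting the exponent with `c ^ m = 1` forces `(c - 1) * m = 0`, so 1-units have no torsion. -/
theorem eq_one_of_isOfFinOrder (hp : p ≠ 2) {c : ℤ_[p]ˣ} (hc : IsOfFinOrder c)
    (h : (p : ℤ_[p]) ∣ c - 1) : c = 1 := by
  obtain ⟨m, hm, hcm⟩ := isOfFinOrder_iff_pow_eq_one.1 hc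
  have h1 := emultiplicity_pow_sub_one hp h m
  have h2 : (c : ℤ_[p]) ^ m = 1 := by rw [← Units.val_pow_eq_pow_val, hcm, Units.val_one]
  rw [h2, sub_self, emultiplicity_zero] at h1
  have h3 : ((c : ℤ_[p]) - 1) * m = 0 := by
    by_contra h0
    exact finiteMultiplicity_iff_emultiplicity_ne_top.1
      (FiniteMultiplicity.of_prime_left prime_p h0) h1.symm
  rcases mul_eq_zero.1 h3 with h3 | h3
  · exact Units.ext (sub_eq_zero.1 h3)
  · exact absurd (Nat.cast_eq_zero.1 h3) hm.ne'

theorem eq_of_isOfFinOrder (hp : p ≠ 2) {c d : ℤ_[p]ˣ} (hc : IsOfFinOrder c)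
    (hd : IsOfFinOrder d) (h : (p : ℤ_[p]) ∣ c - d) : c = d := by
  have h1 : c * d⁻¹ = 1 := by
    refine eq_one_of_isOfFinOrder hp (hc.mul hd.inv) ?_
    have : ((c * d⁻¹ : ℤ_[p]ˣ) : ℤ_[p]) - 1 = (c - d) * (d⁻¹ : ℤ_[p]ˣ) := by
      rw [sub_mul, Units.mul_inv, Units.val_mul]
    rw [this]
    exact h.mul_right _
  exact mul_inv_eq_one.1 h1

theorem pow_sub_one_eq_one (hp : p ≠ 2) {c : ℤ_[p]ˣ} (hc : IsOfFinOrder c) :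
    c ^ (p - 1) = 1 := by
  refine eq_one_of_isOfFinOrder hp hc.pow ?_
  have hpow : toZMod ((c : ℤ_[p]) ^ (p - 1)) = 1 := by
    rw [map_pow]
    exact ZMod.pow_card_sub_one_eq_one (c.isUnit.map toZMod).ne_zero
  have : (c : ℤ_[p]) ^ (p - 1) - 1 ∈ RingHom.ker (toZMod (p := p)) := by
    rw [RingHom.mem_ker, map_sub, hpow, map_one, sub_self]
  rw [ker_toZMod, maximalIdeal_eq_span_p, Ideal.mem_span_singleton] at this
  exact_mod_cast this

/-- The hypothesis `h` encodes `k` as a rounded-up quotient, in a form `omega` can discharge. -/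
theorem pow_dvd_pow_mul_pow_iff {z : ℤ_[p]} (hz : (p : ℤ_[p]) ∣ z) {e k s m : ℕ}
    (h : ∀ r, 1 ≤ r → (e ≤ s + m * r ↔ k ≤ r)) (hm : m ≠ 0) :
    (p : ℤ_[p]) ^ e ∣ (p : ℤ_[p]) ^ s * z ^ m ↔ (p : ℤ_[p]) ^ k ∣ z := by
  rcases eq_or_ne z 0 with rfl | h0
  · simp [hm]
  have hf := FiniteMultiplicity.of_prime_left (prime_p (p := p)) h0
  have hr : 1 ≤ multiplicity (p : ℤ_[p]) z := by
    have := hf.emultiplicity_eq_multiplicity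
    have h1 := pow_dvd_iff_le_emultiplicity.1 (show (p : ℤ_[p]) ^ 1 ∣ z by simpa using hz)
    rw [this] at h1
    exact_mod_cast h1
  rw [pow_dvd_iff_le_emultiplicity, pow_dvd_iff_le_emultiplicity, emultiplicity_mul prime_p,
    emultiplicity_pow_self prime_p.ne_zero prime_p.not_isUnit, emultiplicity_pow prime_p,
    hf.emultiplicity_eq_multiplicity]
  have := h _ hr
  exact_mod_cast this

theorem pow_dvd_natCast_mul_iff {n : ℕ} (hn : n ≠ 0) (j : ℕ) (c : ℤ_[p]) (e : ℕ) :
    (p : ℤ_[p]) ^ e ∣ (n : ℤ_[p]) ^ j * c ↔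
      (p : ℤ_[p]) ^ e ∣ (p : ℤ_[p]) ^ (j * padicValNat p n) * c := by
  obtain ⟨k, m, hm, rfl⟩ := Nat.exists_eq_pow_mul_and_not_dvd hn p (Fact.out : p.Prime).ne_one
  have hv : padicValNat p (p ^ k * m) = k := by
    rw [padicValNat.mul (pow_ne_zero _ (Fact.out : p.Prime).ne_zero) (by rintro rfl; simp at hm),
      padicValNat.prime_pow, padicValNat.eq_zero_of_not_dvd hm, add_zero]
  have hm' : ¬ (p : ℤ_[p]) ∣ (m : ℤ_[p]) ^ j :=
    fun h => hm ((natCast_dvd_iff m).1 (prime_p.dvd_of_dvd_pow h))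
  rw [hv, ← pow_dvd_mul_unit_iff hm' ((p : ℤ_[p]) ^ (j * k) * c)]
  push_cast
  rw [mul_pow, ← pow_mul, mul_comm k j, mul_right_comm]

/-- For `1`-units `A`, `B` with `B ≡ A ^ N`, the congruence `B ^ M ≡ A` in terms of `A` and `N`. -/
theorem pow_dvd_pow_sub_iff (hp : p ≠ 2) {A B : ℤ_[p]} (hA : (p : ℤ_[p]) ∣ A - 1)
    (hB : (p : ℤ_[p]) ∣ B - 1) {n N M e : ℕ} (hN : N ≠ 0) (hM : M ≠ 0)
    (hNM : (N : ℤ_[p]) * M = (A * B) ^ n) (hAB : (p : ℤ_[p]) ^ e ∣ A ^ N - B) :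
    (p : ℤ_[p]) ^ e ∣ B ^ M - A ↔ (p : ℤ_[p]) ^ e ∣ n * ((A - 1) ^ 2 * (N + 1)) := by
  have hABone : (p : ℤ_[p]) ∣ A * B - 1 := by
    have : A * B - 1 = (A - 1) * B + (B - 1) := by ring
    rw [this]
    exact dvd_add (hA.mul_right _) hB
  obtain ⟨m, hm⟩ : ∃ m, N * M = m + 1 := Nat.exists_eq_succ_of_ne_zero (mul_ne_zero hN hM)
  have hm' : (m : ℤ_[p]) = (A * B) ^ n - 1 := by
    rw [← hNM, ← Nat.cast_mul, hm]; push_cast; ring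
  -- Eliminate `B` through `B ≡ A ^ N`; what remains is `A ^ m ≡ 1` with `m = NM - 1`.
  have h1 : (p : ℤ_[p]) ^ e ∣ B ^ M - A ↔ (p : ℤ_[p]) ^ e ∣ A ^ (N * M) - A := by
    refine dvd_iff_dvd_of_dvd_sub ?_
    have h : B ^ M - A - (A ^ (N * M) - A) = -((A ^ N) ^ M - B ^ M) := by
      rw [pow_mul]; ring
    rw [h, dvd_neg]
    exact hAB.trans (sub_dvd_pow_sub_pow _ _ _)
  have h2 : A ^ (N * M) - A = (1 * (A ^ m - 1)) * A := by rw [hm]; ring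
  rw [h1, h2, pow_dvd_mul_unit_iff (not_dvd_of_dvd_sub_one hA),
    pow_dvd_mul_pow_sub_one_iff hp hA, one_mul, hm', pow_dvd_mul_pow_sub_one_iff hp hABone]
  have h3 : (A - 1) * ((A * B - 1) * n) = n * (A - 1) * (A * B - 1) := by ring
  have h4 : (n : ℤ_[p]) * ((A - 1) ^ 2 * (N + 1)) =
      n * (A - 1) * ((A - 1) * (N + 1 : ℕ)) := by push_cast; ring
  rw [h3, h4, ← pow_dvd_mul_pow_sub_one_iff hp hA]
  -- Here `AB` may be replaced by `A ^ (N + 1)`, again because `B ≡ A ^ N`.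
  refine dvd_iff_dvd_of_dvd_sub ?_
  have h5 : (n : ℤ_[p]) * (A - 1) * (A * B - 1) - n * (A - 1) * (A ^ (N + 1) - 1) =
      -(n * (A - 1) * A) * (A ^ N - B) := by ring
  rw [h5]
  exact hAB.mul_left _

end PadicInt

/-! ### Counting residue classes. -/

section Counting

theorem Nat.ModEq.eq_of_mem_Icc {M x y : ℕ} (h : x ≡ y [MOD M]) (hx : 1 ≤ x ∧ x ≤ M)
    (hy : 1 ≤ y ∧ y ≤ M) : x = y := by
  refine h.eq_of_abs_lt ?_
  rw [abs_lt]
  omega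

theorem Nat.exists_mem_Icc_modEq {q r : ℕ} (hqr : q.Coprime r) (hq : q ≠ 0) (hr : r ≠ 0)
    (i j : ℕ) : ∃ x, (1 ≤ x ∧ x ≤ q * r) ∧ x ≡ i [MOD q] ∧ x ≡ j [MOD r] := by
  obtain ⟨z, hz⟩ := Nat.chineseRemainder hqr i j
  have hlt : z % (q * r) < q * r := Nat.mod_lt _ (Nat.pos_of_ne_zero (mul_ne_zero hq hr))
  rcases Nat.eq_zero_or_pos (z % (q * r)) with h0 | h0
  -- The interval starts at `1`, so the zero class is represented by `q * r`.
  · have hd := Nat.dvd_of_mod_eq_zero h0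
    refine ⟨q * r, ⟨by omega, le_rfl⟩, ?_, ?_⟩
    · refine Nat.ModEq.trans ?_ hz.1
      exact ((Nat.modEq_zero_iff_dvd.2 (dvd_mul_right q r)).trans
        (Nat.modEq_zero_iff_dvd.2 ((dvd_mul_right q r).trans hd)).symm)
    · refine Nat.ModEq.trans ?_ hz.2
      exact ((Nat.modEq_zero_iff_dvd.2 (dvd_mul_left r q)).trans
        (Nat.modEq_zero_iff_dvd.2 ((dvd_mul_left r q).trans hd)).symm)
  · have hm := Nat.mod_modEq z (q * r)
    exact ⟨z % (q * r), ⟨h0, hlt.le⟩, (hm.of_dvd (dvd_mul_right q r)).trans hz.1,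
      (hm.of_dvd (dvd_mul_left r q)).trans hz.2⟩

theorem Nat.ncard_lt_modEq {p k e : ℕ} (hp : 0 < p) (hke : k ≤ e) (s : ℕ) :
    {r : ℕ | r < p ^ e ∧ r ≡ s [MOD p ^ k]}.ncard = p ^ (e - k) := by
  have hpk : 0 < p ^ k := pow_pos hp k
  have hmul : p ^ k * p ^ (e - k) = p ^ e := by rw [← pow_add, Nat.add_sub_cancel' hke]
  have h : {r : ℕ | r < p ^ e ∧ r ≡ s [MOD p ^ k]} =
      ((Finset.range (p ^ e)).filter (· ≡ s [MOD p ^ k]) : Finset ℕ) := by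
    ext r; simp
  rw [h, Set.ncard_coe_finset, ← Nat.count_eq_card_filter_range, Nat.count_modEq_card _ hpk, ← hmul]
  simp [hpk]

end Counting

/-! ### Two-cycles and their number. -/

namespace TwoCycle

open PadicInt

variable {p : ℕ} [Fact p.Prime] {n e k : ℕ} {a b : ℤ_[p]ˣ}

/-- Residues modulo `p - 1` of two-cycles in the classes of the roots of unity `a` and `b`. -/
def residuePairs (p : ℕ) [Fact p.Prime] (n : ℕ) (a b : ℤ_[p]ˣ) : Set (ℕ × ℕ) :=
  {z | (z.1 < p - 1 ∧ z.2 < p - 1) ∧ a ^ (z.1 ^ n) = b ∧ b ^ (z.2 ^ n) = a}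

theorem ne_zero_of_dvd_sub {x : ℕ} (hx : (p : ℤ_[p]) ∣ x - a) : x ≠ 0 := by
  rintro rfl
  exact not_dvd_unit a (by simpa using hx)

theorem not_dvd_of_dvd_sub {x : ℕ} (hx : (p : ℤ_[p]) ∣ x - a) : ¬ p ∣ x := by
  intro h
  have h1 := dvd_sub ((natCast_dvd_iff x).2 h) hx
  exact not_dvd_unit a (by simpa using h1)

/-- `k` is the precision to which `A = 1` is forced by a two-cycle modulo `p ^ e`. -/
def IsPrecision (a : ℤ_[p]ˣ) (n e k : ℕ) : Prop :=
  ∀ (A : ℤ_[p]) (N : ℕ), (p : ℤ_[p]) ∣ A - 1 → (N : ℤ_[p]) = (a : ℤ_[p]) ^ n * A ^ n →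
    ((p : ℤ_[p]) ^ e ∣ n * ((A - 1) ^ 2 * (N + 1)) ↔ (p : ℤ_[p]) ^ k ∣ A - 1)

theorem root_eq_of_modEq (hp : p ≠ 2) (ha : IsOfFinOrder a) (hb : IsOfFinOrder b) (he : 1 ≤ e)
    {x y N : ℕ} (hx : (p : ℤ_[p]) ∣ x - a) (hy : (p : ℤ_[p]) ∣ y - b)
    (h : x ^ N ≡ y [MOD p ^ e]) : a ^ N = b := by
  refine eq_of_isOfFinOrder hp ha.pow hb ?_
  have h1 : (p : ℤ_[p]) ∣ (x : ℤ_[p]) ^ N - y := by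
    have := (pow_dvd_natCast_sub_iff _ _ _).2 h
    push_cast at this
    exact (dvd_pow_self _ (by omega)).trans this
  have h2 : ((a ^ N : ℤ_[p]ˣ) : ℤ_[p]) - b = ((x : ℤ_[p]) ^ N - y) + (y - b) -
      ((x : ℤ_[p]) ^ N - (a : ℤ_[p]) ^ N) := by
    push_cast; ring
  rw [h2]
  exact dvd_sub (dvd_add h1 hy) (hx.trans (sub_dvd_pow_sub_pow _ _ _))

theorem second_congr_iff (hp : p ≠ 2) (hab : a ^ n * b ^ n = 1) (hk : IsPrecision a n e k)
    {x y : ℕ} (hx : (p : ℤ_[p]) ∣ x - a) (hy : (p : ℤ_[p]) ∣ y - b)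
    (h1 : a ^ (x ^ n) = b) (h2 : b ^ (y ^ n) = a) (h : x ^ (x ^ n) ≡ y [MOD p ^ e]) :
    y ^ (y ^ n) ≡ x [MOD p ^ e] ↔ (p : ℤ_[p]) ^ k ∣ x - a := by
  obtain ⟨A, hA⟩ : ∃ A : ℤ_[p], (x : ℤ_[p]) = a * A := ⟨(a⁻¹ : ℤ_[p]ˣ) * x, by simp⟩
  obtain ⟨B, hB⟩ : ∃ B : ℤ_[p], (y : ℤ_[p]) = b * B := ⟨(b⁻¹ : ℤ_[p]ˣ) * y, by simp⟩
  have hxA : (x : ℤ_[p]) - a = a * (A - 1) := by rw [hA]; ring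
  have hyB : (y : ℤ_[p]) - b = b * (B - 1) := by rw [hB]; ring
  have hA1 : (p : ℤ_[p]) ∣ A - 1 := by rwa [hxA, Units.dvd_mul_left] at hx
  have hB1 : (p : ℤ_[p]) ∣ B - 1 := by rwa [hyB, Units.dvd_mul_left] at hy
  have h1' : (a : ℤ_[p]) ^ (x ^ n) = b := by rw [← h1]; simp
  have h2' : (b : ℤ_[p]) ^ (y ^ n) = a := by
    rw [← Units.val_pow_eq_pow_val, h2]
  have hab' : (a : ℤ_[p]) ^ n * (b : ℤ_[p]) ^ n = 1 := by
    rw [← Units.val_pow_eq_pow_val, ← Units.val_pow_eq_pow_val, ← Units.val_mul, hab,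
      Units.val_one]
  have hAB : (p : ℤ_[p]) ^ e ∣ A ^ (x ^ n) - B := by
    have h3 := (pow_dvd_natCast_sub_iff _ _ _).2 h
    rwa [Nat.cast_pow, hA, hB, mul_pow, h1', ← mul_sub, Units.dvd_mul_left] at h3
  have hNM : ((x ^ n : ℕ) : ℤ_[p]) * (y ^ n : ℕ) = (A * B) ^ n := by
    push_cast
    rw [hA, hB, ← one_mul ((A * B) ^ n), ← hab']
    ring
  rw [← pow_dvd_natCast_sub_iff, Nat.cast_pow, hB, mul_pow, h2', hxA, hA, ← mul_sub,
    Units.dvd_mul_left, Units.dvd_mul_left,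
    pow_dvd_pow_sub_iff hp hA1 hB1 (pow_ne_zero n (ne_zero_of_dvd_sub hx))
      (pow_ne_zero n (ne_zero_of_dvd_sub hy)) hNM hAB]
  exact hk A _ hA1 (by push_cast; rw [hA, mul_pow])

theorem pow_pow_mod (hp : p ≠ 2) (ha : IsOfFinOrder a) (x : ℕ) :
    a ^ ((x % (p - 1)) ^ n) = a ^ (x ^ n) :=
  pow_eq_pow_of_modEq ((Nat.mod_modEq x (p - 1)).pow n) (pow_sub_one_eq_one hp ha)

theorem mem_twoCycles_iff (hp : p ≠ 2) (ha : IsOfFinOrder a) (hb : IsOfFinOrder b)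
    (hab : a ^ n * b ^ n = 1) (he : 1 ≤ e) (hk1 : 1 ≤ k) (hk : IsPrecision a n e k)
    {s : ℕ} (hs : (p : ℤ_[p]) ^ k ∣ a - s) {x y : ℕ} :
    (x, y) ∈ twoCycles p n a b e ↔
      (1 ≤ x ∧ x ≤ p ^ e * (p - 1)) ∧ (1 ≤ y ∧ y ≤ p ^ e * (p - 1)) ∧
      (a ^ (x ^ n) = b ∧ b ^ (y ^ n) = a) ∧ x ≡ s [MOD p ^ k] ∧
      x ^ (x ^ n) ≡ y [MOD p ^ e] := by
  have hxs : x ≡ s [MOD p ^ k] ↔ (p : ℤ_[p]) ^ k ∣ x - a := by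
    rw [← pow_dvd_natCast_sub_iff]
    exact dvd_iff_dvd_of_dvd_sub (by simpa using hs)
  rw [hxs]
  constructor
  · rintro ⟨hx, hy, -, -, hxa, hyb, h1, h2⟩
    have e1 := root_eq_of_modEq hp ha hb he hxa hyb h1
    have e2 := root_eq_of_modEq hp hb ha he hyb hxa h2
    exact ⟨hx, hy, ⟨e1, e2⟩, (second_congr_iff hp hab hk hxa hyb e1 e2 h1).1 h2, h1⟩
  · rintro ⟨hx, hy, ⟨e1, e2⟩, hxa, h1⟩
    have hxa' : (p : ℤ_[p]) ∣ x - a := (dvd_pow_self _ (by omega)).trans hxa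
    have hyb : (p : ℤ_[p]) ∣ y - b := by
      have h3 := (pow_dvd_natCast_sub_iff (p := p) _ _ _).2 h1
      have h4 : (p : ℤ_[p]) ∣ (x : ℤ_[p]) ^ (x ^ n) - y := by
        push_cast at h3
        exact (dvd_pow_self _ (by omega)).trans h3
      have h5 : (y : ℤ_[p]) - b = ((x : ℤ_[p]) ^ (x ^ n) - (a : ℤ_[p]) ^ (x ^ n)) -
          ((x : ℤ_[p]) ^ (x ^ n) - y) := by
        rw [← e1]; push_cast; ring
      rw [h5]
      exact dvd_sub (hxa'.trans (sub_dvd_pow_sub_pow _ _ _)) h4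
    exact ⟨hx, hy, not_dvd_of_dvd_sub hxa', not_dvd_of_dvd_sub hyb, hxa', hyb, h1,
      (second_congr_iff hp hab hk hxa' hyb e1 e2 h1).2 hxa⟩

theorem ncard_twoCycles (hp : p ≠ 2) (ha : IsOfFinOrder a) (hb : IsOfFinOrder b)
    (hab : a ^ n * b ^ n = 1) (he : 1 ≤ e) (hk1 : 1 ≤ k) (hke : k ≤ e)
    (hk : IsPrecision a n e k) :
    (twoCycles p n a b e).ncard = (residuePairs p n a b).ncard * p ^ (e - k) := by
  have hpp : p.Prime := Fact.out
  have hp1 : p - 1 ≠ 0 := by have := hpp.two_le; omega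
  have hcop : (p ^ e).Coprime (p - 1) := by
    refine Nat.Coprime.pow_left e ((hpp.coprime_iff_not_dvd).2 fun h => ?_)
    exact absurd (Nat.le_of_dvd (by omega) h) (by omega)
  obtain ⟨s, hs⟩ : ∃ s : ℕ, (p : ℤ_[p]) ^ k ∣ a - s :=
    ⟨appr (a : ℤ_[p]) k, Ideal.mem_span_singleton.1 (appr_spec k (a : ℤ_[p]))⟩
  have hmem := fun x y => mem_twoCycles_iff hp ha hb hab he hk1 hk hs (x := x) (y := y)
  rw [← Nat.ncard_lt_modEq hpp.pos hke s, ← Set.ncard_prod]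
  -- The residue of `y` mod `p ^ e` is omitted: the first congruence recovers it from `x`.
  refine Set.BijOn.ncard_eq (f := fun z => ((z.1 % (p - 1), z.2 % (p - 1)), z.1 % p ^ e)) ?_
  refine ⟨?_, ?_, ?_⟩
  · rintro ⟨x, y⟩ hz
    obtain ⟨-, -, ⟨e1, e2⟩, hxs, -⟩ := (hmem x y).1 hz
    refine ⟨⟨⟨Nat.mod_lt _ (by omega), Nat.mod_lt _ (by omega)⟩, ?_, ?_⟩,
      Nat.mod_lt _ (pow_pos hpp.pos e), ?_⟩
    · exact (pow_pow_mod hp ha x).trans e1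
    · exact (pow_pow_mod hp hb y).trans e2
    · exact ((Nat.mod_modEq x (p ^ e)).of_dvd (pow_dvd_pow p hke)).trans hxs
  · rintro ⟨x, y⟩ hz ⟨x', y'⟩ hz' heq
    obtain ⟨hx, hy, -, -, h⟩ := (hmem x y).1 hz
    obtain ⟨hx', hy', -, -, h'⟩ := (hmem x' y').1 hz'
    simp only [Prod.mk.injEq] at heq
    obtain ⟨⟨h1, h2⟩, h3⟩ := heq
    obtain rfl : x = x' :=
      ((Nat.modEq_and_modEq_iff_modEq_mul hcop).1 ⟨h3, h1⟩).eq_of_mem_Icc hx hx'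
    obtain rfl : y = y' :=
      ((Nat.modEq_and_modEq_iff_modEq_mul hcop).1 ⟨h.symm.trans h', h2⟩).eq_of_mem_Icc hy hy'
    rfl
  · rintro ⟨⟨i, j⟩, r⟩ ⟨⟨⟨hi, hj⟩, e1, e2⟩, hr, hrs⟩
    obtain ⟨x, hx, hxr, hxi⟩ := Nat.exists_mem_Icc_modEq hcop (pow_ne_zero e hpp.ne_zero) hp1 r i
    obtain ⟨y, hy, hyr, hyj⟩ :=
      Nat.exists_mem_Icc_modEq hcop (pow_ne_zero e hpp.ne_zero) hp1 (x ^ (x ^ n)) j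
    have hxi' : x % (p - 1) = i := Eq.trans hxi (Nat.mod_eq_of_lt hi)
    have hyj' : y % (p - 1) = j := Eq.trans hyj (Nat.mod_eq_of_lt hj)
    have hxr' : x % p ^ e = r := Eq.trans hxr (Nat.mod_eq_of_lt hr)
    refine ⟨(x, y), (hmem x y).2 ⟨hx, hy, ⟨?_, ?_⟩,
      (hxr.of_dvd (pow_dvd_pow p hke)).trans hrs, hyr.symm⟩, ?_⟩
    · rw [← pow_pow_mod hp ha, hxi']; exact e1
    · rw [← pow_pow_mod hp hb, hyj']; exact e2
    · simp only [hxi', hyj', hxr']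

/-- `N + 1 ≡ a ^ n + 1` mod `p` is a unit, as distinct roots of unity differ mod `p`. -/
theorem isPrecision_of_ne (hp : p ≠ 2) (ha : IsOfFinOrder a) (hn : n ≠ 0) (hne : a ^ n ≠ -1)
    (h : ∀ r, 1 ≤ r → (e ≤ padicValNat p n + 2 * r ↔ k ≤ r)) : IsPrecision a n e k := by
  intro A N hA hN
  have hunit : ¬ (p : ℤ_[p]) ∣ (N : ℤ_[p]) + 1 := by
    intro hd
    refine hne (eq_of_isOfFinOrder hp ha.pow
      (isOfFinOrder_iff_pow_eq_one.2 ⟨2, by norm_num, by simp⟩) ?_)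
    have h1 : ((a ^ n : ℤ_[p]ˣ) : ℤ_[p]) - (-1 : ℤ_[p]ˣ) =
        (N + 1) - (a : ℤ_[p]) ^ n * (A ^ n - 1) := by
      rw [hN]; push_cast; ring
    rw [h1]
    exact dvd_sub hd (Dvd.dvd.mul_left (hA.trans (by simpa using sub_dvd_pow_sub_pow A 1 n)) _)
  rw [← mul_assoc, pow_dvd_mul_unit_iff hunit, ← pow_dvd_pow_mul_pow_iff hA h two_ne_zero]
  simpa using pow_dvd_natCast_mul_iff hn 1 ((A - 1) ^ 2) e

/-- Now `N + 1 = 1 - A ^ n`, which contributes another factor `n * (A - 1)` up to a unit. -/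
theorem isPrecision_of_eq (hp : p ≠ 2) (hn : n ≠ 0) (heq : a ^ n = -1)
    (h : ∀ r, 1 ≤ r → (e ≤ 2 * padicValNat p n + 3 * r ↔ k ≤ r)) : IsPrecision a n e k := by
  intro A N hA hN
  have han : (a : ℤ_[p]) ^ n = -1 := by
    rw [← Units.val_pow_eq_pow_val, heq, Units.val_neg, Units.val_one]
  have h1 : (n : ℤ_[p]) * ((A - 1) ^ 2 * (N + 1)) = -(n * (A - 1) ^ 2 * (A ^ n - 1)) := by
    rw [hN, han]; ring
  have h2 : (n : ℤ_[p]) * (A - 1) ^ 2 * ((A - 1) * n) = (n : ℤ_[p]) ^ 2 * (A - 1) ^ 3 := by ring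
  rw [h1, dvd_neg, pow_dvd_mul_pow_sub_one_iff hp hA, h2, pow_dvd_natCast_mul_iff hn,
    pow_dvd_pow_mul_pow_iff hA h three_ne_zero]

end TwoCycle

open TwoCycle in
theorem theorem4p6 (p : ℕ) [Fact p.Prime] (hp : p ≠ 2) (n : ℕ) (hn : 0 < n) (hpn : p ∣ n)
    (a b : ℤ_[p]ˣ) (ha : IsOfFinOrder a) (hb : IsOfFinOrder b)
    (hab : b ^ n = a ^ (-(n : ℤ))) (e : ℕ) (he : 1 ≤ e) :
    (b ^ n ≠ -1 → e ≤ padicValNat p n →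
      (twoCycles p n a b e).ncard = (twoCycles p n a b 1).ncard * p ^ (e - 1)) ∧
    (b ^ n ≠ -1 → padicValNat p n + 1 ≤ e →
      (twoCycles p n a b e).ncard =
        (twoCycles p n a b 1).ncard * p ^ ((e + padicValNat p n) / 2)) ∧
    (b ^ n = -1 → e ≤ 2 * padicValNat p n →
      (twoCycles p n a b e).ncard = (twoCycles p n a b 1).ncard * p ^ (e - 1)) ∧
    (b ^ n = -1 → 2 * padicValNat p n + 1 ≤ e →
      (twoCycles p n a b e).ncard =
        (twoCycles p n a b 1).ncard *
          p ^ ((e + padicValNat p n) / 3 + (e + padicValNat p n + 1) / 3)) := by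
  have hv : 1 ≤ padicValNat p n := one_le_padicValNat_of_dvd hn.ne' hpn
  have hbn : b ^ n = (a ^ n)⁻¹ := by rw [hab, zpow_neg, zpow_natCast]
  have hab' : a ^ n * b ^ n = 1 := by rw [hbn, mul_inv_cancel]
  have hiff : b ^ n = -1 ↔ a ^ n = -1 := by
    rw [hbn, inv_eq_iff_eq_inv, inv_neg, inv_one]
  have hcard : ∀ {e k : ℕ}, 1 ≤ e → 1 ≤ k → k ≤ e → IsPrecision a n e k →
      (twoCycles p n a b e).ncard = (residuePairs p n a b).ncard * p ^ (e - k) :=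
    fun h1 h2 h3 h4 => ncard_twoCycles hp ha hb hab' h1 h2 h3 h4
  have hbase : (twoCycles p n a b 1).ncard = (residuePairs p n a b).ncard := by
    have h : IsPrecision a n 1 1 := by
      by_cases h : a ^ n = -1
      · exact isPrecision_of_eq hp hn.ne' h (by omega)
      · exact isPrecision_of_ne hp ha hn.ne' h (by omega)
    simpa using hcard le_rfl le_rfl le_rfl h
  rw [hbase]
  refine ⟨fun h h1 => ?_, fun h h1 => ?_, fun h h1 => ?_, fun h h1 => ?_⟩
  · exact hcard he le_rfl he (isPrecision_of_ne hp ha hn.ne' (mt hiff.2 h) (by omega))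
  -- `k = ⌈(e - v) / 2⌉`, the least `r` with `e ≤ v + 2r`.
  · rw [hcard (k := (e - padicValNat p n + 1) / 2) he (by omega) (by omega)
      (isPrecision_of_ne hp ha hn.ne' (mt hiff.2 h) (by omega))]
    congr 2
    omega
  · exact hcard he le_rfl he (isPrecision_of_eq hp hn.ne' (hiff.1 h) (by omega))
  -- `k = ⌈(e - 2v) / 3⌉`, so `e - k = ⌊2(e + v) / 3⌋`, which splits into the two stated floors.
  · rw [hcard (k := (e - 2 * padicValNat p n + 2) / 3) he (by omega) (by omega)
      (isPrecision_of_eq hp hn.ne' (hiff.1 h) (by omega))]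
    congr 2
    omega
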